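/- **Equilibrium under immediate release with an oversight compliance fee.** *Setting.* Executors $1,\dots,n$ hold shares $\alpha_i\ge 0$, $\sum_i\alpha_i=1$, of the consensus resource. The set $R\subseteq[n]$ is regulated, $\bar R=[n]\setminus R$ is not, and $\alpha_R=\sum_{i\in R}\alpha_i$. Blocks are notarized one after the other and released immediately; independently each time, the notarizer is executor $i$ with probability $\alpha_i$. Blocks of $R$ (regulated blocks) are legal; blocks of $\bar R$ are legal or dubious, as $\bar R$ chooses. *Game.* The two players $R$ and $\bar R$ build a block tree of width two above a root block, initially the genesis block. A state $(b_{\bar R},b_R)$ consists of $b_{\bar R}$ blocks on the branch of $\bar R$ and $b_R$ blocks on the branch of $R$. Before each notarization $\bar R$ chooses the type of its next block (legal or dubious) and one of the following: (a) to extend its own branch; (b) to abandon that branch and build on the block that has exactly $s$ blocks of the regulated branch above it, $0\le s\le b_R$ ($s=b_R$ being the root); that block becomes the root and the state becomes $(0,s)$. If all blocks on the branch of $\bar R$ are legal and $b_{\bar R}=b_R+1$, then $R$ moves to that branch, the branch of $R$ is orphaned, the last block of $\bar R$ becomes the root and the state becomes $(0,0)$. The game depth is $E=\infty$. $R$ follows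 the longest legal branch rule: it notarizes regulated blocks at the end of the longest legal branch, which is its own branch unless it is overtaken in this way. For each of its blocks $R$ decides whether the block carries the oversight compliance fee $\rho_{\mathcal F}$, which is paid by the regulator to the notarizer of the next block on top of it in the blockchain. Both players may use arbitrary history-dependent strategies of this kind. *Gain.* A player's reward on a chain is the number of its blocks in the chain plus $\rho_{\mathcal F}$ for each of its blocks whose predecessor carries the fee. Its expected gain per epoch over the first $d$ epochs (epoch = block height) is $\frac1d$ times its expected reward on the longest legal branch when that branch first has height $d$. A pair of strategies is a Nash equilibrium if the gains per epoch of both players converge as $d\to\infty$ and no player can, by deviating alone, obtain a gain per epoch with a limit superior larger than its limit under the pair. *Theorem.* There is a fee $\rho_{\mathcal F}=\rho_{\mathcal F}(\alpha_R)>0$, depending only on $\alpha_R$, such that whenever $\alpha_R>0.5$, the following is a Nash equilibrium: $R$ plays $\mathrm{RegFrontier}(\rho_{\mathcal F})$ (regulated blocks at the end of the longest legal branch, each carrying the fee) and $\bar R$ plays $\mathrm{LegFrontier}$ (legal blocks at the end of the longest legal branch). -/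

import Mathlib

open MeasureTheory Filter Topology

namespace RegulatedChain

/-- The two players: the regulated executors `R` and the unregulated executors `R̄`. -/
inductive Player
  | regulated
  | unregulated
  deriving DecidableEq

/-- A notarized block. A regulated block (always legal) may carry the oversight compliance fee;
a block of an unregulated executor is legal or dubious, and never carries the fee. -/
inductive Block
  | regulated (fee : Bool)
  | unregulated (legal : Bool)

/-- The player whose executors notarized the block. -/
def Block.owner : Block → Player
  | .regulated _ => .regulated
  | .unregulated _ => .unregulated

/-- Whether the block carries the oversight compliance fee. -/
def Block.hasFee : Block → Bool
  | .regulated fee => fee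
  | .unregulated _ => false

/-- The fee that the notarizer of the next block on top of `chain` claims. Chains are lists of
blocks, newest block first; the empty chain is the genesis block, which carries no fee. -/
def feeOnTop (ρ : ℝ) : List Block → ℝ
  | [] => 0
  | B :: _ => if B.hasFee then ρ else 0

/-- Total reward of player `P` on a chain: one unit for each block notarized by `P`, plus the fee
`ρ` for each such block whose predecessor carries the fee. -/
def reward (ρ : ℝ) (P : Player) : List Block → ℝ
  | [] => 0
  | B :: chain => (if B.owner = P then 1 + feeOnTop ρ chain else 0) + reward ρ P chain

/-- A position of the game: a block tree of width two. All lists are newest block first.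
* `trunk` is the common part of the blockchain; its newest block is the root block of the fork.
* `reg` is the branch of the regulated executors above the root (`b_R` is its length); an entry
  records whether that regulated block carries the fee.
* `unreg` is the branch of the unregulated executors above the root (`b_R̄` is its length); an
  entry is `true` if that block is legal and `false` if it is dubious. -/
structure State where
  trunk : List Block
  reg : List Bool
  unreg : List Bool

/-- The game starts at the genesis block. -/
def State.initial : State := ⟨[], [], []⟩

/-- The longest legal branch of the blockchain, ending in the block on which the regulated
executors notarize. The competing branch replaces it as soon as it is legal and strictly longer
(see `notarizeUnreg`). -/
def State.legalChain (s : State) : List Block :=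
  s.reg.map Block.regulated ++ s.trunk

/-- A choice of the unregulated executors.
* `target = none`: keep notarizing on their own branch.
* `target = some k`: abandon their own branch and notarize on the block that has exactly `k`
  blocks of the regulated branch above it. For `k < b_R` this is a block of the regulated branch
  (the frontier block of that branch if `k = 0`), for `k = b_R` it is the root block.
* `legal`: whether the block they try to notarize is legal or dubious. -/
structure Move (s : State) where
  target : Option (Fin (s.reg.length + 1))
  legal : Bool

/-- The position after the unregulated executors have selected the block to notarize on. If they
abandon their branch, the selected block becomes the root and the game starts afresh from
`(0, k)`. -/
def relocate (s : State) : Option (Fin (s.reg.length + 1)) → State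
  | none => s
  | some k => ⟨(s.reg.drop k).map Block.regulated ++ s.trunk, s.reg.take k, []⟩

/-- A regulated executor notarizes and releases a regulated block on the longest legal branch. -/
def notarizeReg (s : State) (fee : Bool) : State :=
  { s with reg := fee :: s.reg }

/-- An unregulated executor notarizes and releases a block on the unregulated branch. If all blocks
of that branch are legal and it is now one block longer than the regulated branch, it is
the longest legal branch: the regulated executors move to it, their own branch is orphaned, and
the game starts afresh from `(0, 0)`. -/
def notarizeUnreg (s : State) (legal : Bool) : State :=
  if (∀ x ∈ legal :: s.unreg, x = true) ∧ s.unreg.length + 1 = s.reg.length + 1 then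
    ⟨(legal :: s.unreg).map Block.unregulated ++ s.trunk, [], []⟩
  else
    { s with unreg := legal :: s.unreg }

/-- What has been observed: the past positions, each with the executor who notarized the block
there (latest first). -/
abbrev History (n : ℕ) := List (State × Fin n)

/-- A strategy of the regulated executors under the longest legal branch rule. The rule fixes that
they notarize regulated blocks at the frontier of the longest legal branch; they decide, depending
on the history and the position, whether the block carries the fee. -/
abbrev RegStrategy (n : ℕ) := History n → State → Bool

/-- A strategy of the unregulated executors: any choice of moves depending on the history and the
position. -/
abbrev UnregStrategy (n : ℕ) := History n → (s : State) → Move s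

/-- `RegFrontier(ρ)`: regulated blocks at the frontier of the longest legal branch, each of them
carrying the fee. -/
def regFrontierOCF (n : ℕ) : RegStrategy n := fun _ _ => true

/-- `LegFrontier`: legal blocks at the frontier of the longest legal branch. -/
def legFrontier (n : ℕ) : UnregStrategy n := fun _ _ => ⟨some 0, true⟩

/-- History and position after `t` blocks have been notarized, where `ω t` is the executor who
notarizes the block number `t` (counted from `0`) and `R` is the set of regulated executors. -/
def run {n : ℕ} (R : Finset (Fin n)) (σR : RegStrategy n) (σU : UnregStrategy n)
    (ω : ℕ → Fin n) : ℕ → History n × State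
  | 0 => ([], State.initial)
  | t + 1 =>
    let h := (run R σR σU ω t).1
    let s := (run R σR σU ω t).2
    let s' := relocate s (σU h s).target
    ((s, ω t) :: h,
      if ω t ∈ R then notarizeReg s' (σR h s) else notarizeUnreg s' (σU h s).legal)

/-- The longest legal branch after `t` blocks have been notarized. -/
def chainAt {n : ℕ} (R : Finset (Fin n)) (σR : RegStrategy n) (σU : UnregStrategy n)
    (ω : ℕ → Fin n) (t : ℕ) : List Block :=
  (run R σR σU ω t).2.legalChain

open Classical in
/-- The reward of player `P` in the first `d` epochs of the blockchain: its reward on the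
longest legal branch at the first time when this branch has height `d` (epochs are block heights).
If regulated executors have positive resource, every height is reached almost surely. -/
noncomputable def epochReward {n : ℕ} (R : Finset (Fin n)) (ρ : ℝ) (σR : RegStrategy n)
    (σU : UnregStrategy n) (P : Player) (d : ℕ) (ω : ℕ → Fin n) : ℝ :=
  if h : ∃ t, (chainAt R σR σU ω t).length = d then
    reward ρ P (chainAt R σR σU ω (Nat.find h))
  else 0

/-- The law of the sequence of notarizing executors: independently, each block is notarized by
executor `i` with probability `α i`, its share of the consensus resource. -/
noncomputable def notarizerLaw {n : ℕ} (α : PMF (Fin n)) : Measure (ℕ → Fin n) :=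
  Measure.infinitePi fun _ : ℕ => α.toMeasure

/-- The expected reward per epoch of player `P` over the first `d` epochs. -/
noncomputable def gain {n : ℕ} (α : PMF (Fin n)) (R : Finset (Fin n)) (ρ : ℝ)
    (σR : RegStrategy n) (σU : UnregStrategy n) (P : Player) (d : ℕ) : ℝ :=
  (∫ ω, epochReward R ρ σR σU P d ω ∂(notarizerLaw α)) / d

/-- Nash equilibrium for the long-run expected gain per epoch: under `(σR, σU)` both gains
converge, to `gR` and `gU`, and no unilateral deviation yields a player asymptotically more (the
limit superior of the gain of the deviating player is at most `gR`, respectively `gU`). -/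
def IsNashEquilibrium {n : ℕ} (α : PMF (Fin n)) (R : Finset (Fin n)) (ρ : ℝ)
    (σR : RegStrategy n) (σU : UnregStrategy n) : Prop :=
  ∃ gR gU : ℝ,
    Tendsto (gain α R ρ σR σU .regulated) atTop (𝓝 gR) ∧
    Tendsto (gain α R ρ σR σU .unregulated) atTop (𝓝 gU) ∧
    (∀ τ : RegStrategy n, ∀ ε > 0, ∀ᶠ d in atTop, gain α R ρ τ σU .regulated d ≤ gR + ε) ∧
    (∀ τ : UnregStrategy n, ∀ ε > 0, ∀ᶠ d in atTop, gain α R ρ σR τ .unregulated d ≤ gU + ε)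

/-- The total consensus resource of a set of executors. -/
noncomputable def resource {n : ℕ} (α : PMF (Fin n)) (S : Finset (Fin n)) : ℝ :=
  ∑ i ∈ S, (α i).toReal

end RegulatedChain

/-! Write `p` for the regulated resource. For `p < 1` take the fee `ρ = 1 / (1 - p)`: a pending fee
is then worth `(1 - p) * ρ = 1` in expectation to the unregulated side, and honest play earns it `(1
- p) * (1 + p * ρ) = 1` per epoch.

No deviation earns it more. Charge 1 per epoch to its reward on the longest legal branch and add a
value for the position: the length of its branch while legal, plus 1 if a fee is pending
(`State.value`). This potential is a supermartingale under every move (`isSupersolution_value`).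
Extending a legal branch without overtaking gains 1 with probability `1 - p`, but a regulated block
then loses the pending fee, worth 1, with probability `p > 1/2`. Overtaking collects at most the fee
below the fork and gives up the pending one. Stopping at height `d` turns this into a bound on the
gain (`gain_unregulated_le`).

Against `legFrontier` every block extends the chain whatever the fees are, so attaching all fees is
pointwise best for the regulated side (`reward_chainAt_le_regFrontierOCF`). The equilibrium gains
follow from an exact one-step recursion (`integral_reward_add_fee_frontier`). -/

namespace RegulatedChain

open Function

/-! ### Averaging over a single notarizer -/

section Law

variable {n : ℕ} (α : PMF (Fin n))

instance isProbabilityMeasure_notarizerLaw : IsProbabilityMeasure (notarizerLaw α) := by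
  unfold notarizerLaw; infer_instance

/-- Resampling a single notarizer does not change the law of the notarizer sequence. -/
theorem map_update_notarizerLaw (t : ℕ) :
    ((notarizerLaw α).prod α.toMeasure).map (fun x => update x.1 t x.2) = notarizerLaw α := by
  refine Measure.eq_infinitePi _ fun s A hA => ?_
  have hm : Measurable fun x : (ℕ → Fin n) × Fin n => update x.1 t x.2 := measurable_update'
  rw [Measure.map_apply hm (.pi s.countable_toSet fun i _ => hA i)]
  have hset : (fun x : (ℕ → Fin n) × Fin n => update x.1 t x.2) ⁻¹' Set.pi s A
      = (Set.pi (s.erase t) A) ×ˢ (if t ∈ s then A t else Set.univ) := by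
    ext ⟨ω, i⟩
    simp only [Set.mem_preimage, Set.mem_pi, Set.mem_prod, Finset.mem_coe, Finset.mem_erase]
    constructor
    · intro h
      refine ⟨fun j hj => by simpa [hj.1] using h j hj.2, ?_⟩
      split_ifs with ht
      · simpa using h t ht
      · trivial
    · rintro ⟨h1, h2⟩ j hj
      by_cases hjt : j = t
      · subst hjt; simpa [hj] using h2
      · simpa [hjt] using h1 j ⟨hjt, hj⟩
  rw [hset, Measure.prod_prod, notarizerLaw, Measure.infinitePi_pi _ fun i _ => hA i]
  split_ifs with ht
  · exact Finset.prod_erase_mul s _ ht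
  · rw [Finset.erase_eq_of_notMem ht, measure_univ, mul_one]

/-- This plays the role of conditioning on all notarizers other than number `t`; expectations along
the game are computed one step at a time with it. -/
theorem integral_notarizerLaw_eq_integral_update (t : ℕ) {f : (ℕ → Fin n) → ℝ}
    (hf : Integrable f (notarizerLaw α)) :
    ∫ ω, f ω ∂(notarizerLaw α)
      = ∫ ω, ∑ i, (α i).toReal * f (update ω t i) ∂(notarizerLaw α) := by
  have hm : Measurable fun x : (ℕ → Fin n) × Fin n => update x.1 t x.2 := measurable_update'
  have hmap := map_update_notarizerLaw α t
  have hf' : Integrable f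
      (((notarizerLaw α).prod α.toMeasure).map (fun x => update x.1 t x.2)) := by rwa [hmap]
  calc ∫ ω, f ω ∂(notarizerLaw α)
      = ∫ ω, f ω ∂(((notarizerLaw α).prod α.toMeasure).map (fun x => update x.1 t x.2)) := by
        rw [hmap]
    _ = ∫ x, f (update x.1 t x.2) ∂((notarizerLaw α).prod α.toMeasure) :=
        integral_map hm.aemeasurable hf'.aestronglyMeasurable
    _ = ∫ ω, ∫ i, f (update ω t i) ∂α.toMeasure ∂(notarizerLaw α) :=
        integral_prod _ (hf'.comp_measurable hm)
    _ = _ := by simp only [PMF.integral_eq_sum, smul_eq_mul]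

variable {α}

/-- Such a function factors through the finitely many words of length `t`, so arbitrary strategies
raise no measurability question. -/
theorem integrable_of_dependsOn_Iio {t : ℕ} {f : (ℕ → Fin n) → ℝ}
    (hf : DependsOn f (Set.Iio t)) : Integrable f (notarizerLaw α) := by
  obtain ⟨g, rfl⟩ := dependsOn_iff_exists_comp.1 hf
  have hm : Measurable ((Set.Iio t).domRestrict : (ℕ → Fin n) → _) := by fun_prop
  have : Finite (Set.Iio t) := (Set.finite_Iio t).to_subtype
  have hp : IsProbabilityMeasure ((notarizerLaw α).map (Set.Iio t).domRestrict) :=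
    Measure.isProbabilityMeasure_map hm.aemeasurable
  have hg : Integrable g ((notarizerLaw α).map (Set.Iio t).domRestrict) := .of_finite
  exact hg.comp_measurable hm

theorem sum_toReal_eq_one (α : PMF (Fin n)) : ∑ i, (α i).toReal = 1 := by
  have h := α.tsum_coe
  rw [tsum_fintype] at h
  rw [← ENNReal.toReal_sum fun i _ => α.apply_ne_top i, h, ENNReal.toReal_one]

theorem resource_nonneg (α : PMF (Fin n)) (R : Finset (Fin n)) : 0 ≤ resource α R :=
  Finset.sum_nonneg fun _ _ => ENNReal.toReal_nonneg

theorem resource_le_one (α : PMF (Fin n)) (R : Finset (Fin n)) : resource α R ≤ 1 := by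
  rw [← sum_toReal_eq_one α]
  exact Finset.sum_le_univ_sum_of_nonneg fun _ => ENNReal.toReal_nonneg

theorem sum_ite_mem_eq (α : PMF (Fin n)) (R : Finset (Fin n)) (A B : ℝ) :
    ∑ i, (α i).toReal * (if i ∈ R then A else B)
      = resource α R * A + (1 - resource α R) * B := by
  have hsplit : ∀ i, (α i).toReal * (if i ∈ R then A else B)
      = (if i ∈ R then (α i).toReal else 0) * (A - B) + (α i).toReal * B := by
    intro i; split_ifs <;> ring
  simp only [hsplit, Finset.sum_add_distrib, ← Finset.sum_mul, sum_toReal_eq_one,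
    Finset.sum_ite_mem, Finset.univ_inter]
  unfold resource
  ring

end Law

/-! ### Rewards along a chain -/

section Rewards

variable {ρ : ℝ}

theorem feeOnTop_cons (ρ : ℝ) (B : Block) (c : List Block) :
    feeOnTop ρ (B :: c) = if B.hasFee then ρ else 0 := rfl

theorem reward_cons (ρ : ℝ) (P : Player) (B : Block) (c : List Block) :
    reward ρ P (B :: c) = (if B.owner = P then 1 + feeOnTop ρ c else 0) + reward ρ P c := rfl

theorem feeOnTop_nonneg (hρ : 0 ≤ ρ) : ∀ c : List Block, 0 ≤ feeOnTop ρ c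
  | [] => le_rfl
  | B :: c => by rw [feeOnTop_cons]; split_ifs <;> simp [hρ]

theorem feeOnTop_le (hρ : 0 ≤ ρ) : ∀ c : List Block, feeOnTop ρ c ≤ ρ
  | [] => hρ
  | B :: c => by rw [feeOnTop_cons]; split_ifs <;> simp [hρ]

theorem feeOnTop_eq_mul (ρ : ℝ) : ∀ c : List Block, feeOnTop ρ c = ρ * feeOnTop 1 c
  | [] => by simp [feeOnTop]
  | B :: c => by rw [feeOnTop_cons, feeOnTop_cons]; split_ifs <;> simp

theorem reward_nonneg (hρ : 0 ≤ ρ) (P : Player) : ∀ c : List Block, 0 ≤ reward ρ P c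
  | [] => le_rfl
  | B :: c => by
    have h1 := feeOnTop_nonneg hρ c
    have h2 := reward_nonneg hρ P c
    rw [reward_cons]
    split_ifs <;> linarith

theorem reward_le (hρ : 0 ≤ ρ) (P : Player) :
    ∀ c : List Block, reward ρ P c ≤ c.length * (1 + ρ)
  | [] => by simp [reward]
  | B :: c => by
    have h1 := feeOnTop_le hρ c
    have h2 := reward_le hρ P c
    rw [reward_cons]
    push_cast [List.length_cons]
    split_ifs <;> linarith

theorem reward_unregulated_map_regulated_append (c : List Block) :
    ∀ l : List Bool, reward ρ .unregulated (l.map Block.regulated ++ c) = reward ρ .unregulated c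
  | [] => rfl
  | b :: l => by simp [reward, Block.owner, reward_unregulated_map_regulated_append c l]

theorem feeOnTop_map_unregulated_append (c : List Block) {l : List Bool} (hl : l ≠ []) :
    feeOnTop ρ (l.map Block.unregulated ++ c) = 0 := by
  obtain ⟨b, l, rfl⟩ := List.exists_cons_of_ne_nil hl
  simp [feeOnTop, Block.hasFee]

/-- Unregulated blocks carry no fee, so only the lowest block of the branch can claim one, from the
root block. -/
theorem reward_unregulated_cons_map_unregulated_append (c : List Block) (b : Bool) :
    ∀ l : List Bool, reward ρ .unregulated ((b :: l).map Block.unregulated ++ c)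
      = reward ρ .unregulated c + (l.length + 1) + feeOnTop ρ c
  | [] => by simp [reward, Block.owner]; ring
  | b' :: l => by
    have ih := reward_unregulated_cons_map_unregulated_append c b' l
    have h0 : feeOnTop ρ ((b' :: l).map Block.unregulated ++ c) = 0 :=
      feeOnTop_map_unregulated_append c (List.cons_ne_nil _ _)
    rw [List.map_cons, List.cons_append, reward, ih, h0]
    simp [Block.owner]
    ring

end Rewards

/-! ### Effect of a single move on a position -/

section Positions

theorem legalChain_relocate (s : State) (k : Option (Fin (s.reg.length + 1))) :
    (relocate s k).legalChain = s.legalChain := by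
  cases k with
  | none => rfl
  | some k =>
    simp only [relocate, State.legalChain]
    rw [← List.append_assoc, ← List.map_append, List.take_append_drop]

theorem legalChain_notarizeReg (s : State) (fee : Bool) :
    (notarizeReg s fee).legalChain = .regulated fee :: s.legalChain := rfl

theorem length_legalChain_notarizeUnreg_le (s : State) (legal : Bool) :
    (notarizeUnreg s legal).legalChain.length ≤ s.legalChain.length + 1 := by
  unfold notarizeUnreg
  split_ifs with h
  · simp only [State.legalChain, List.map_nil, List.nil_append, List.length_append,
      List.length_map, List.length_cons]
    omega
  · exact Nat.le_succ _

/-- The positions that occur when every regulated block carries the fee: a legal unregulated branch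
is at most as long as the regulated one. -/
def State.IsAdmissible (s : State) : Prop :=
  (∀ x ∈ s.reg, x = true) ∧ ((∀ x ∈ s.unreg, x = true) → s.unreg.length ≤ s.reg.length)

theorem State.isAdmissible_initial : State.initial.IsAdmissible := by
  simp [State.IsAdmissible, State.initial]

theorem State.IsAdmissible.relocate {s : State} (hs : s.IsAdmissible)
    (k : Option (Fin (s.reg.length + 1))) : (relocate s k).IsAdmissible := by
  cases k with
  | none => exact hs
  | some k => exact ⟨fun x hx => hs.1 x (List.mem_of_mem_take hx), fun _ => Nat.zero_le _⟩

theorem State.IsAdmissible.notarizeReg {s : State} (hs : s.IsAdmissible) :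
    (notarizeReg s true).IsAdmissible :=
  ⟨by simpa [RegulatedChain.notarizeReg] using hs.1, fun h => (hs.2 h).trans (Nat.le_succ _)⟩

theorem State.IsAdmissible.notarizeUnreg {s : State} (hs : s.IsAdmissible) (legal : Bool) :
    (notarizeUnreg s legal).IsAdmissible := by
  unfold RegulatedChain.notarizeUnreg
  split_ifs with h
  · simp [State.IsAdmissible]
  · refine ⟨hs.1, fun hl => ?_⟩
    have h1 := hs.2 fun x hx => hl x (List.mem_cons_of_mem _ hx)
    -- A legal branch as long as the regulated one would have overtaken with this block.
    have h2 : s.unreg.length + 1 ≠ s.reg.length + 1 := fun h' => h ⟨hl, h'⟩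
    change s.unreg.length + 1 ≤ s.reg.length
    omega

end Positions

/-! ### Runs of the game and the hitting time of a height -/

section Run

variable {n : ℕ} {R : Finset (Fin n)} {σR : RegStrategy n} {σU : UnregStrategy n}

/-- History and position after one more notarization, by executor `i`. -/
def advance (R : Finset (Fin n)) (σR : RegStrategy n) (σU : UnregStrategy n)
    (x : History n × State) (i : Fin n) : History n × State :=
  ((x.2, i) :: x.1,
    if i ∈ R then notarizeReg (relocate x.2 (σU x.1 x.2).target) (σR x.1 x.2)
    else notarizeUnreg (relocate x.2 (σU x.1 x.2).target) (σU x.1 x.2).legal)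

theorem run_succ (ω : ℕ → Fin n) (t : ℕ) :
    run R σR σU ω (t + 1) = advance R σR σU (run R σR σU ω t) (ω t) := rfl

theorem run_congr {ω ω' : ℕ → Fin n} : ∀ {t : ℕ}, (∀ k < t, ω k = ω' k) →
    run R σR σU ω t = run R σR σU ω' t
  | 0, _ => rfl
  | t + 1, h => by
    rw [run_succ, run_succ, run_congr fun k hk => h k (Nat.lt_succ_of_lt hk),
      h t (Nat.lt_succ_self t)]

theorem run_update_self (ω : ℕ → Fin n) (t : ℕ) (i : Fin n) :
    run R σR σU (update ω t i) t = run R σR σU ω t :=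
  run_congr fun _ hk => update_of_ne hk.ne _ _

theorem run_succ_snd (ω : ℕ → Fin n) (t : ℕ) : ∃ m : Move (run R σR σU ω t).2, ∃ fee : Bool,
    fee = σR (run R σR σU ω t).1 (run R σR σU ω t).2 ∧
    m = σU (run R σR σU ω t).1 (run R σR σU ω t).2 ∧
    (run R σR σU ω (t + 1)).2 = if ω t ∈ R
      then notarizeReg (relocate (run R σR σU ω t).2 m.target) fee
      else notarizeUnreg (relocate (run R σR σU ω t).2 m.target) m.legal :=
  ⟨_, _, rfl, rfl, rfl⟩

theorem length_chainAt_succ_le (ω : ℕ → Fin n) (t : ℕ) :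
    (chainAt R σR σU ω (t + 1)).length ≤ (chainAt R σR σU ω t).length + 1 := by
  obtain ⟨m, fee, -, -, h⟩ := run_succ_snd (R := R) (σR := σR) (σU := σU) ω t
  unfold chainAt
  rw [h]
  split_ifs
  · rw [legalChain_notarizeReg, List.length_cons, legalChain_relocate]
  · exact (length_legalChain_notarizeUnreg_le _ _).trans (by rw [legalChain_relocate])

theorem chainAt_zero (ω : ℕ → Fin n) : chainAt R σR σU ω 0 = [] := rfl

theorem isAdmissible_run (ω : ℕ → Fin n) :
    ∀ t, (run R (regFrontierOCF n) σU ω t).2.IsAdmissible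
  | 0 => State.isAdmissible_initial
  | t + 1 => by
    obtain ⟨m, fee, rfl, -, h⟩ := run_succ_snd (R := R) (σR := regFrontierOCF n) (σU := σU) ω t
    rw [h]
    have hr := (isAdmissible_run ω t).relocate m.target
    split_ifs
    · exact hr.notarizeReg
    · exact hr.notarizeUnreg _

/-- Whether the longest legal branch has had height `d` after at most `t` notarizations. -/
def Reached (R : Finset (Fin n)) (σR : RegStrategy n) (σU : UnregStrategy n) (d t : ℕ)
    (ω : ℕ → Fin n) : Prop :=
  ∃ k ≤ t, (chainAt R σR σU ω k).length = d

/-- The height starts at 0 and grows by at most 1 per notarization, so it cannot jump over `d`. -/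
theorem length_chainAt_lt_of_not_reached {d : ℕ} {ω : ℕ → Fin n} :
    ∀ {t : ℕ}, ¬ Reached R σR σU d t ω → (chainAt R σR σU ω t).length < d
  | 0, h => by
    have h0 : (chainAt R σR σU ω 0).length ≠ d := fun h' => h ⟨0, le_rfl, h'⟩
    simp only [chainAt_zero, List.length_nil] at h0 ⊢
    omega
  | t + 1, h => by
    have h1 : (chainAt R σR σU ω t).length < d :=
      length_chainAt_lt_of_not_reached fun ⟨k, hk, h'⟩ => h ⟨k, hk.trans (Nat.le_succ t), h'⟩
    have h2 := length_chainAt_succ_le (R := R) (σR := σR) (σU := σU) ω t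
    have h3 : (chainAt R σR σU ω (t + 1)).length ≠ d := fun h' => h ⟨t + 1, le_rfl, h'⟩
    omega

variable {ρ : ℝ} {P : Player}

theorem epochReward_eq {d m : ℕ} {ω : ℕ → Fin n} (hm : (chainAt R σR σU ω m).length = d)
    (hlt : ∀ k < m, (chainAt R σR σU ω k).length ≠ d) :
    epochReward R ρ σR σU P d ω = reward ρ P (chainAt R σR σU ω m) := by
  classical
  have h : ∃ t, (chainAt R σR σU ω t).length = d := ⟨m, hm⟩
  have hf : Nat.find h = m := (Nat.find_eq_iff h).2 ⟨hm, hlt⟩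
  unfold epochReward
  rw [dif_pos h]
  convert! rfl
  exact hf.symm

theorem Reached.exists_first {d t : ℕ} {ω : ℕ → Fin n} (h : Reached R σR σU d t ω) :
    ∃ m ≤ t, (chainAt R σR σU ω m).length = d ∧ ∀ k < m, (chainAt R σR σU ω k).length ≠ d := by
  classical
  obtain ⟨k, hk, hd⟩ := h
  have h : ∃ t, (chainAt R σR σU ω t).length = d := ⟨k, hd⟩
  exact ⟨Nat.find h, (Nat.find_min' h hd).trans hk, Nat.find_spec h, fun _ => Nat.find_min h⟩

theorem chainAt_congr {ω ω' : ℕ → Fin n} {t : ℕ} (h : ∀ k < t, ω k = ω' k) {k : ℕ} (hk : k ≤ t) :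
    chainAt R σR σU ω k = chainAt R σR σU ω' k := by
  unfold chainAt
  rw [run_congr fun j hj => h j (hj.trans_le hk)]

theorem reached_congr {d t : ℕ} {ω ω' : ℕ → Fin n} (h : ∀ k < t, ω k = ω' k) :
    Reached R σR σU d t ω ↔ Reached R σR σU d t ω' :=
  exists_congr fun _ => and_congr_right fun hk => by rw [chainAt_congr h hk]

/-- The first time of height `d` is a stopping time: if it is at most `t`, the first `t` notarizers
determine it and the chain at that time. -/
theorem Reached.epochReward_congr {d t : ℕ} {ω ω' : ℕ → Fin n} (h : ∀ k < t, ω k = ω' k)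
    (hr : Reached R σR σU d t ω) :
    epochReward R ρ σR σU P d ω = epochReward R ρ σR σU P d ω' := by
  obtain ⟨m, hmt, hm, hlt⟩ := hr.exists_first
  rw [epochReward_eq hm hlt, chainAt_congr h hmt, epochReward_eq (m := m)]
  · rwa [← chainAt_congr h hmt]
  · intro k hk
    rw [← chainAt_congr h (hk.le.trans hmt)]
    exact hlt k hk

theorem epochReward_mem_Icc (hρ : 0 ≤ ρ) (d : ℕ) (ω : ℕ → Fin n) :
    epochReward R ρ σR σU P d ω ∈ Set.Icc 0 (d * (1 + ρ)) := by
  classical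
  by_cases h : ∃ t, (chainAt R σR σU ω t).length = d
  · obtain ⟨t, ht⟩ := h
    obtain ⟨m, -, hm, hlt⟩ := Reached.exists_first ⟨t, le_rfl, ht⟩
    rw [epochReward_eq hm hlt]
    refine ⟨reward_nonneg hρ P _, ?_⟩
    have := reward_le hρ P (chainAt R σR σU ω m)
    rwa [hm] at this
  · unfold epochReward
    rw [dif_neg h]
    exact ⟨le_rfl, by positivity⟩

end Run

/-! ### Supermartingale bound for unregulated deviations -/

section Supermartingale

variable {n : ℕ} {α : PMF (Fin n)} {R : Finset (Fin n)} {σU : UnregStrategy n} {ρ lam : ℝ}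
  {V : State → ℝ}

/-- The reward of the unregulated executors on the longest legal branch, charged `lam` for each
epoch, plus the value `V` of the position. -/
noncomputable def potential (ρ lam : ℝ) (V : State → ℝ) (s : State) : ℝ :=
  reward ρ .unregulated s.legalChain - lam * s.legalChain.length + V s

open Classical in
/-- The process `potential`, shifted by `lam * d` and stopped at height `d`. -/
noncomputable def stoppedPotential (R : Finset (Fin n)) (ρ lam : ℝ) (V : State → ℝ)
    (σU : UnregStrategy n) (d t : ℕ) (ω : ℕ → Fin n) : ℝ :=
  if Reached R (regFrontierOCF n) σU d t ω then
    epochReward R ρ (regFrontierOCF n) σU .unregulated d ω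
  else potential ρ lam V (run R (regFrontierOCF n) σU ω t).2 + lam * d

/-- `V` makes `potential` a supermartingale against all moves of the unregulated executors when
`p` is the resource of the regulated executors, all of whose blocks carry the fee. -/
def IsSupersolution (p ρ lam : ℝ) (V : State → ℝ) : Prop :=
  ∀ s : State, s.IsAdmissible → ∀ m : Move s,
    p * potential ρ lam V (notarizeReg (relocate s m.target) true)
      + (1 - p) * potential ρ lam V (notarizeUnreg (relocate s m.target) m.legal)
      ≤ potential ρ lam V s

theorem dependsOn_stoppedPotential (d t : ℕ) :
    DependsOn (stoppedPotential R ρ lam V σU d t) (Set.Iio t) := by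
  intro ω ω' h
  have h' : ∀ k < t, ω k = ω' k := h
  unfold stoppedPotential
  by_cases hr : Reached R (regFrontierOCF n) σU d t ω
  · rw [if_pos hr, if_pos ((reached_congr h').1 hr), hr.epochReward_congr h']
  · rw [if_neg hr, if_neg (fun h => hr ((reached_congr h').2 h)), run_congr h']

/-- Stopping exactly at time `t` discards the value `V ≥ 0` of the position and cancels the charge
against `lam * d`. This covers the step at which height `d` is first reached. -/
theorem stoppedPotential_le (hV : ∀ s, 0 ≤ V s) {d t : ℕ} {ω : ℕ → Fin n}
    (h : ∀ k < t, (chainAt R (regFrontierOCF n) σU ω k).length ≠ d) :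
    stoppedPotential R ρ lam V σU d t ω
      ≤ potential ρ lam V (run R (regFrontierOCF n) σU ω t).2 + lam * d := by
  unfold stoppedPotential
  split_ifs with hr
  · obtain ⟨m, hmt, hm, hlt⟩ := hr.exists_first
    obtain rfl : m = t := hmt.antisymm (not_lt.1 fun hlt' => h m hlt' hm)
    rw [epochReward_eq hm hlt, ← hm]
    have := hV (run R (regFrontierOCF n) σU ω m).2
    unfold potential chainAt
    linarith
  · exact le_rfl

/-- One-step supermartingale inequality: once height `d` has been reached the process is frozen, and
before that the supersolution property applies to the move actually played. -/
theorem sum_stoppedPotential_update_le (hV : ∀ s, 0 ≤ V s)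
    (hsup : IsSupersolution (resource α R) ρ lam V) (d t : ℕ) (ω : ℕ → Fin n) :
    ∑ i, (α i).toReal * stoppedPotential R ρ lam V σU d (t + 1) (update ω t i)
      ≤ stoppedPotential R ρ lam V σU d t ω := by
  have hupd : ∀ i, ∀ k < t, ω k = update ω t i k := fun i k hk => (update_of_ne hk.ne _ _).symm
  by_cases hr : Reached R (regFrontierOCF n) σU d t ω
  · have hi : ∀ i, stoppedPotential R ρ lam V σU d (t + 1) (update ω t i)
        = stoppedPotential R ρ lam V σU d t ω := by
      intro i
      obtain ⟨k, hk, hd⟩ := (reached_congr (hupd i)).1 hr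
      unfold stoppedPotential
      rw [if_pos hr, if_pos ⟨k, hk.trans (Nat.le_succ t), hd⟩, hr.epochReward_congr (hupd i)]
    simp only [hi, ← Finset.sum_mul, sum_toReal_eq_one, one_mul, le_refl]
  · set s := (run R (regFrontierOCF n) σU ω t).2 with hs
    set m := σU (run R (regFrontierOCF n) σU ω t).1 s with hm
    have hi : ∀ i, stoppedPotential R ρ lam V σU d (t + 1) (update ω t i)
        ≤ if i ∈ R then potential ρ lam V (notarizeReg (relocate s m.target) true) + lam * d
          else potential ρ lam V (notarizeUnreg (relocate s m.target) m.legal) + lam * d := by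
      intro i
      refine (stoppedPotential_le hV fun k hk hd => hr ?_).trans (le_of_eq ?_)
      · exact (reached_congr (hupd i)).2 ⟨k, Nat.lt_succ_iff.1 hk, hd⟩
      · rw [run_succ, run_update_self, update_self, advance]
        split_ifs <;> rfl
    calc _ ≤ ∑ i, (α i).toReal * (if i ∈ R
            then potential ρ lam V (notarizeReg (relocate s m.target) true) + lam * d
            else potential ρ lam V (notarizeUnreg (relocate s m.target) m.legal) + lam * d) :=
          Finset.sum_le_sum fun i _ => mul_le_mul_of_nonneg_left (hi i) ENNReal.toReal_nonneg
      _ ≤ potential ρ lam V s + lam * d := by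
          rw [sum_ite_mem_eq]
          have := hsup s (isAdmissible_run ω t) m
          linarith
      _ = _ := by unfold stoppedPotential; rw [if_neg hr]

theorem integral_stoppedPotential_le (hV : ∀ s, 0 ≤ V s)
    (hsup : IsSupersolution (resource α R) ρ lam V) (d : ℕ) : ∀ t,
    ∫ ω, stoppedPotential R ρ lam V σU d t ω ∂(notarizerLaw α) ≤ V State.initial + lam * d
  | 0 => by
    have h : ∀ ω, stoppedPotential R ρ lam V σU d 0 ω ≤ V State.initial + lam * d := fun ω =>
      (stoppedPotential_le hV fun k hk => absurd hk k.not_lt_zero).trans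
        (le_of_eq (by simp [potential, run, State.initial, State.legalChain, reward]))
    calc _ ≤ ∫ _, (V State.initial + lam * d) ∂(notarizerLaw α) :=
          integral_mono (integrable_of_dependsOn_Iio (dependsOn_stoppedPotential d 0))
            (integrable_const _) h
      _ = _ := by simp
  | t + 1 => by
    have hint := integrable_of_dependsOn_Iio (α := α)
      (dependsOn_stoppedPotential (R := R) (ρ := ρ) (lam := lam) (V := V) (σU := σU) d (t + 1))
    rw [integral_notarizerLaw_eq_integral_update α t hint]
    refine le_trans (integral_mono ?_ ?_ (sum_stoppedPotential_update_le hV hsup d t))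
      (integral_stoppedPotential_le hV hsup d t)
    · refine integrable_of_dependsOn_Iio (t := t) fun ω ω' h => ?_
      refine Finset.sum_congr rfl fun i _ => ?_
      rw [dependsOn_stoppedPotential d (t + 1)]
      intro k hk
      by_cases hkt : k = t
      · simp [hkt]
      · simpa [hkt] using h k (lt_of_le_of_ne (Nat.lt_succ_iff.1 hk) hkt)
    · exact integrable_of_dependsOn_Iio (dependsOn_stoppedPotential d t)

/-- The reward collected by time `t`, set to 0 if height `d` is not yet reached, is at most the
stopped potential, whose mean is at most `lam * d`; then `t → ∞`. -/
theorem gain_unregulated_le (hρ : 0 ≤ ρ) (hlam : 0 ≤ lam) (hV : ∀ s, 0 ≤ V s)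
    (hV0 : V State.initial = 0) (hsup : IsSupersolution (resource α R) ρ lam V)
    (σU : UnregStrategy n) (d : ℕ) :
    gain α R ρ (regFrontierOCF n) σU .unregulated d ≤ lam := by
  classical
  let f : (ℕ → Fin n) → ℝ := epochReward R ρ (regFrontierOCF n) σU .unregulated d
  let F : ℕ → (ℕ → Fin n) → ℝ := fun t ω =>
    if Reached R (regFrontierOCF n) σU d t ω then f ω else 0
  have hF : ∀ t, Integrable (F t) (notarizerLaw α) := by
    refine fun t => integrable_of_dependsOn_Iio (t := t) fun ω ω' h => ?_
    have h' : ∀ k < t, ω k = ω' k := h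
    by_cases hr : Reached R (regFrontierOCF n) σU d t ω
    · simp only [F, f, if_pos hr, if_pos ((reached_congr h').1 hr), hr.epochReward_congr h']
    · simp only [F, if_neg hr, if_neg (fun h => hr ((reached_congr h').2 h))]
  have hFle : ∀ t, ∫ ω, F t ω ∂(notarizerLaw α) ≤ lam * d := by
    intro t
    have := integral_stoppedPotential_le (σU := σU) hV hsup d t
    rw [hV0, zero_add] at this
    refine le_trans (integral_mono (hF t)
      (integrable_of_dependsOn_Iio (dependsOn_stoppedPotential d t)) fun ω => ?_) this
    simp only [F]
    unfold stoppedPotential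
    split_ifs with hr
    · exact le_rfl
    -- Below height `d` the stopped potential is nonnegative, since at most `lam * d` has been
    -- charged.
    · have hlt : ((chainAt R (regFrontierOCF n) σU ω t).length : ℝ) ≤ d :=
        Nat.cast_le.2 (length_chainAt_lt_of_not_reached hr).le
      have h1 := mul_le_mul_of_nonneg_left hlt hlam
      have h2 := reward_nonneg hρ .unregulated (chainAt R (regFrontierOCF n) σU ω t)
      have h3 := hV (run R (regFrontierOCF n) σU ω t).2
      unfold chainAt at h1 h2
      unfold potential
      linarith
  have hlim : Tendsto (fun t => ∫ ω, F t ω ∂(notarizerLaw α)) atTop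
      (𝓝 (∫ ω, f ω ∂(notarizerLaw α))) := by
    refine tendsto_integral_of_dominated_convergence (fun _ => d * (1 + ρ))
      (fun t => (hF t).aestronglyMeasurable) (integrable_const _)
      (fun t => ae_of_all _ fun ω => ?_) (ae_of_all _ fun ω => ?_)
    · have h := epochReward_mem_Icc (R := R) (σR := regFrontierOCF n) (σU := σU)
        (P := .unregulated) hρ d ω
      simp only [F]
      split_ifs
      · rw [Real.norm_of_nonneg h.1]; exact h.2
      · rw [norm_zero]; exact h.1.trans h.2
    · refine tendsto_const_nhds.congr' ?_
      by_cases h : ∃ t, (chainAt R (regFrontierOCF n) σU ω t).length = d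
      · obtain ⟨t, ht⟩ := h
        filter_upwards [eventually_ge_atTop t] with u hu
        simp only [F, if_pos (show Reached R (regFrontierOCF n) σU d u ω from ⟨t, hu, ht⟩)]
      -- If height `d` is never reached, `epochReward` takes its default value 0, and so does every
      -- `F u`.
      · refine Eventually.of_forall fun u => ?_
        have hu : ¬ Reached R (regFrontierOCF n) σU d u ω := fun ⟨k, _, hk⟩ => h ⟨k, hk⟩
        simp only [F, f, if_neg hu]
        unfold epochReward
        rw [dif_neg h]
  have hle : ∫ ω, f ω ∂(notarizerLaw α) ≤ lam * d := le_of_tendsto' hlim hFle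
  rcases Nat.eq_zero_or_pos d with rfl | hd
  · simpa [gain] using hlam
  · exact (div_le_iff₀ (Nat.cast_pos.2 hd)).2 hle

end Supermartingale

/-! ### The value function for the fee `1 / (1 - p)` -/

section Value

/-- The advantage of a position for the unregulated executors: the length of their branch if that
is still legal, and one unit if the next block on the longest legal branch earns a fee. -/
noncomputable def State.value (s : State) : ℝ :=
  (if ∀ x ∈ s.unreg, x = true then (s.unreg.length : ℝ) else 0) + feeOnTop 1 s.legalChain

theorem State.value_nonneg (s : State) : 0 ≤ s.value := by
  have := feeOnTop_nonneg zero_le_one s.legalChain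
  unfold State.value
  split_ifs <;> positivity

theorem State.value_initial : State.initial.value = 0 := by
  simp [State.value, State.initial, State.legalChain, feeOnTop]

theorem value_relocate_le (s : State) (k : Option (Fin (s.reg.length + 1))) :
    (relocate s k).value ≤ s.value := by
  unfold State.value
  rw [legalChain_relocate]
  cases k with
  | none => exact le_rfl
  | some k =>
    simp only [relocate, List.not_mem_nil, false_imp_iff, implies_true, if_true, List.length_nil,
      Nat.cast_zero]
    split_ifs <;> simp

theorem State.IsAdmissible.feeOnTop_legalChain {s : State} (hs : s.IsAdmissible)
    (h : s.reg ≠ []) : feeOnTop 1 s.legalChain = 1 := by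
  obtain ⟨b, l, hbl⟩ := List.exists_cons_of_ne_nil h
  have hb : b = true := hs.1 b (by simp [hbl])
  simp [State.legalChain, hbl, hb, feeOnTop, Block.hasFee]

theorem value_notarizeReg (s : State) : (notarizeReg s true).value
    = (if ∀ x ∈ s.unreg, x = true then (s.unreg.length : ℝ) else 0) + 1 := rfl

/-- With `e` the pending fee in units of `ρ`, a regulated block changes the potential by `-e`. An
overtaking block changes it by `e' / (1 - p) - e`, where `e'` is the fee on top of the root, for a
mean drift of `e' - e ≤ 0`. Any other unregulated block adds at most 1, and adds it only when `e =
1`, for a drift of at most `1 - 2 * p`. -/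
theorem isSupersolution_value {p : ℝ} (hp : 1 / 2 < p) (hp1 : p < 1) :
    IsSupersolution p (1 / (1 - p)) 1 State.value := by
  intro s₀ hs₀ m
  -- Relocating keeps the legal chain and can only forfeit the branch, so only the drift after
  -- relocation remains to be bounded.
  have hle : potential (1 / (1 - p)) 1 State.value (relocate s₀ m.target)
      ≤ potential (1 / (1 - p)) 1 State.value s₀ := by
    unfold potential
    rw [legalChain_relocate]
    linarith [value_relocate_le s₀ m.target]
  refine le_trans ?_ hle
  have hs := hs₀.relocate m.target
  generalize relocate s₀ m.target = s at hs ⊢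
  have hq : 0 < 1 - p := sub_pos.2 hp1
  have he := feeOnTop_nonneg zero_le_one s.legalChain
  have hpot : potential (1 / (1 - p)) 1 State.value (notarizeReg s true)
      = potential (1 / (1 - p)) 1 State.value s - feeOnTop 1 s.legalChain := by
    unfold potential
    rw [value_notarizeReg, legalChain_notarizeReg, State.value, List.length_cons]
    simp only [reward, Block.owner, reduceCtorEq, if_false]
    push_cast
    ring
  rw [hpot]
  suffices (1 - p) * potential (1 / (1 - p)) 1 State.value (notarizeUnreg s m.legal)
      ≤ (1 - p) * potential (1 / (1 - p)) 1 State.value s + p * feeOnTop 1 s.legalChain by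
    linarith
  by_cases h : (∀ x ∈ m.legal :: s.unreg, x = true) ∧ s.unreg.length + 1 = s.reg.length + 1
  · have hall : ∀ x ∈ s.unreg, x = true := fun x hx => h.1 x (List.mem_cons_of_mem _ hx)
    have hlen : s.unreg.length = s.reg.length := Nat.succ_injective h.2
    have htop : feeOnTop 1 s.trunk ≤ feeOnTop 1 s.legalChain := by
      by_cases hr : s.reg = []
      · simp [State.legalChain, hr]
      · rw [hs.feeOnTop_legalChain hr]
        exact feeOnTop_le zero_le_one _
    have hU : potential (1 / (1 - p)) 1 State.value (notarizeUnreg s m.legal)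
        = potential (1 / (1 - p)) 1 State.value s - feeOnTop 1 s.legalChain
          + feeOnTop 1 s.trunk / (1 - p) := by
      unfold potential notarizeUnreg State.value
      rw [if_pos h, if_pos hall]
      simp only [State.legalChain, List.map_nil, List.nil_append,
        reward_unregulated_map_regulated_append, reward_unregulated_cons_map_unregulated_append,
        List.length_append, List.length_map, List.length_cons, List.not_mem_nil, false_imp_iff,
        implies_true, if_true, List.length_nil,
        feeOnTop_map_unregulated_append _ (List.cons_ne_nil m.legal s.unreg),
        feeOnTop_eq_mul (1 / (1 - p)), hlen]
      push_cast
      ring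
    rw [hU, mul_add, mul_sub, mul_div_cancel₀ _ hq.ne']
    linarith
  · have hU : potential (1 / (1 - p)) 1 State.value (notarizeUnreg s m.legal)
        = reward (1 / (1 - p)) .unregulated s.legalChain - 1 * s.legalChain.length
          + ((if ∀ x ∈ m.legal :: s.unreg, x = true then ((s.unreg.length + 1 : ℕ) : ℝ) else 0)
            + feeOnTop 1 s.legalChain) := by
      unfold potential notarizeUnreg
      rw [if_neg h]
      rfl
    have hext : (1 - p) * (if ∀ x ∈ m.legal :: s.unreg, x = true
          then ((s.unreg.length + 1 : ℕ) : ℝ) else 0)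
        ≤ (1 - p) * (if ∀ x ∈ s.unreg, x = true then (s.unreg.length : ℝ) else 0)
          + p * feeOnTop 1 s.legalChain := by
      by_cases hl : ∀ x ∈ m.legal :: s.unreg, x = true
      · have hall : ∀ x ∈ s.unreg, x = true := fun x hx => hl x (List.mem_cons_of_mem _ hx)
        -- With no regulated branch, admissibility makes the unregulated one empty, and a legal
        -- block would overtake at once.
        have hne : s.reg ≠ [] := by
          intro h0
          have h1 := hs.2 hall
          exact h ⟨hl, by simp_all⟩
        rw [if_pos hl, if_pos hall, hs.feeOnTop_legalChain hne]
        push_cast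
        linarith
      · rw [if_neg hl, mul_zero]
        split_ifs <;> positivity
    rw [hU]
    unfold potential State.value
    linarith

/-- Almost surely only regulated blocks occur, and they leave the unregulated reward unchanged. -/
theorem isSupersolution_zero {p ρ : ℝ} (hp : p = 1) : IsSupersolution p ρ 0 fun _ => 0 := by
  intro s _ m
  simp [hp, potential, legalChain_notarizeReg, reward, Block.owner, legalChain_relocate]

end Value

/-! ### Equilibrium play and regulated deviations -/

section Frontier

variable {n : ℕ} {α : PMF (Fin n)} {R : Finset (Fin n)} {ρ : ℝ}

theorem legalChain_notarizeUnreg_true_of_nil {s : State} (hr : s.reg = []) (hu : s.unreg = []) :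
    (notarizeUnreg s true).legalChain = .unregulated true :: s.legalChain := by
  simp [notarizeUnreg, State.legalChain, hr, hu]

theorem chainAt_legFrontier_succ (σR : RegStrategy n) (ω : ℕ → Fin n) (t : ℕ) :
    chainAt R σR (legFrontier n) ω (t + 1)
      = (if ω t ∈ R then
          .regulated (σR (run R σR (legFrontier n) ω t).1 (run R σR (legFrontier n) ω t).2)
        else .unregulated true) :: chainAt R σR (legFrontier n) ω t := by
  obtain ⟨m, fee, rfl, hm, h⟩ := run_succ_snd (R := R) (σR := σR) (σU := legFrontier n) ω t
  have hm' : m = ⟨some 0, true⟩ := hm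
  subst hm'
  unfold chainAt
  rw [h]
  split_ifs
  · rw [legalChain_notarizeReg, legalChain_relocate]
  · rw [legalChain_notarizeUnreg_true_of_nil rfl rfl, legalChain_relocate]

theorem length_chainAt_legFrontier (σR : RegStrategy n) (ω : ℕ → Fin n) :
    ∀ t, (chainAt R σR (legFrontier n) ω t).length = t
  | 0 => rfl
  | t + 1 => by
    rw [chainAt_legFrontier_succ, List.length_cons, length_chainAt_legFrontier σR ω t]

theorem epochReward_legFrontier (σR : RegStrategy n) (P : Player) (d : ℕ) (ω : ℕ → Fin n) :
    epochReward R ρ σR (legFrontier n) P d ω = reward ρ P (chainAt R σR (legFrontier n) ω d) :=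
  epochReward_eq (length_chainAt_legFrontier σR ω d) fun k hk => by
    rw [length_chainAt_legFrontier]; exact hk.ne

theorem integrable_comp_chainAt (σR : RegStrategy n) (σU : UnregStrategy n)
    (f : List Block → ℝ) (t : ℕ) :
    Integrable (fun ω => f (chainAt R σR σU ω t)) (notarizerLaw α) :=
  integrable_of_dependsOn_Iio (t := t) fun ω ω' h => by
    have h' : ∀ k < t, ω k = ω' k := h
    simp only [chainAt_congr h' le_rfl]

/-- Against `legFrontier` the owners of the blocks do not depend on the fees, so more fees can only
increase rewards, for either player. -/
theorem reward_chainAt_le_regFrontierOCF (hρ : 0 ≤ ρ) (σR : RegStrategy n) (P : Player)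
    (ω : ℕ → Fin n) : ∀ t,
    feeOnTop ρ (chainAt R σR (legFrontier n) ω t)
        ≤ feeOnTop ρ (chainAt R (regFrontierOCF n) (legFrontier n) ω t) ∧
      reward ρ P (chainAt R σR (legFrontier n) ω t)
        ≤ reward ρ P (chainAt R (regFrontierOCF n) (legFrontier n) ω t)
  | 0 => ⟨le_rfl, le_rfl⟩
  | t + 1 => by
    obtain ⟨h1, h2⟩ := reward_chainAt_le_regFrontierOCF hρ σR P ω t
    rw [chainAt_legFrontier_succ, chainAt_legFrontier_succ]
    simp only [feeOnTop_cons, reward_cons]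
    by_cases h : ω t ∈ R
    · simp only [if_pos h, Block.hasFee, Block.owner, regFrontierOCF, if_true]
      change _ ∧ _ ≤ (if _ then
          1 + feeOnTop ρ (chainAt R (regFrontierOCF n) (legFrontier n) ω t) else 0)
        + reward ρ P (chainAt R (regFrontierOCF n) (legFrontier n) ω t)
      refine ⟨by split_ifs <;> simp [hρ], ?_⟩
      split_ifs <;> linarith
    · simp only [if_neg h, Block.hasFee, Block.owner]
      refine ⟨le_rfl, ?_⟩
      split_ifs <;> linarith

theorem gain_regulated_le_regFrontierOCF (hρ : 0 ≤ ρ) (σR : RegStrategy n) (P : Player) (d : ℕ) :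
    gain α R ρ σR (legFrontier n) P d ≤ gain α R ρ (regFrontierOCF n) (legFrontier n) P d := by
  refine div_le_div_of_nonneg_right ?_ (Nat.cast_nonneg d)
  simp only [epochReward_legFrontier]
  exact integral_mono (integrable_comp_chainAt _ _ _ d) (integrable_comp_chainAt _ _ _ d)
    fun ω => (reward_chainAt_le_regFrontierOCF hρ σR P ω d).2

/-- The total resource of a player. -/
noncomputable def share (α : PMF (Fin n)) (R : Finset (Fin n)) : Player → ℝ
  | .regulated => resource α R
  | .unregulated => 1 - resource α R

theorem share_mem_Icc (P : Player) : share α R P ∈ Set.Icc 0 1 := by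
  have h0 := resource_nonneg α R
  have h1 := resource_le_one α R
  cases P <;> constructor <;> simp only [share] <;> linarith

/-- The pending fee goes to `P` with probability `share α R P`. Adding this expected claim to the
reward makes the increment of the mean the same at every step. -/
theorem integral_reward_add_fee_frontier (ρ : ℝ) (P : Player) : ∀ d : ℕ,
    ∫ ω, (reward ρ P (chainAt R (regFrontierOCF n) (legFrontier n) ω d)
        + share α R P * feeOnTop ρ (chainAt R (regFrontierOCF n) (legFrontier n) ω d))
      ∂(notarizerLaw α) = d * (share α R P * (1 + resource α R * ρ))
  | 0 => by simp [chainAt_zero, reward, feeOnTop]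
  | d + 1 => by
    rw [integral_notarizerLaw_eq_integral_update α d
      (integrable_comp_chainAt _ _ (fun c => reward ρ P c + share α R P * feeOnTop ρ c) (d + 1))]
    have hstep : ∀ ω : ℕ → Fin n, ∑ i, (α i).toReal *
        (reward ρ P (chainAt R (regFrontierOCF n) (legFrontier n) (update ω d i) (d + 1))
          + share α R P *
            feeOnTop ρ (chainAt R (regFrontierOCF n) (legFrontier n) (update ω d i) (d + 1)))
        = (reward ρ P (chainAt R (regFrontierOCF n) (legFrontier n) ω d)
          + share α R P * feeOnTop ρ (chainAt R (regFrontierOCF n) (legFrontier n) ω d))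
          + share α R P * (1 + resource α R * ρ) := by
      intro ω
      set c := chainAt R (regFrontierOCF n) (legFrontier n) ω d with hc
      have hc' : ∀ i, chainAt R (regFrontierOCF n) (legFrontier n) (update ω d i) d = c :=
        fun i => chainAt_congr (fun k hk => update_of_ne hk.ne _ _) le_rfl
      have hi : ∀ i, reward ρ P
            (chainAt R (regFrontierOCF n) (legFrontier n) (update ω d i) (d + 1))
          + share α R P *
            feeOnTop ρ (chainAt R (regFrontierOCF n) (legFrontier n) (update ω d i) (d + 1))
          = if i ∈ R then
              (reward ρ P (.regulated true :: c)
                + share α R P * feeOnTop ρ (.regulated true :: c))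
            else (reward ρ P (.unregulated true :: c)
                + share α R P * feeOnTop ρ (.unregulated true :: c)) := by
        intro i
        rw [chainAt_legFrontier_succ, hc', update_self]
        split_ifs <;> rfl
      simp only [hi, sum_ite_mem_eq]
      cases P <;> simp [reward, Block.owner, feeOnTop, Block.hasFee, share] <;> ring
    simp only [hstep]
    rw [integral_add (integrable_comp_chainAt _ _
      (fun c => reward ρ P c + share α R P * feeOnTop ρ c) d) (integrable_const _),
      integral_reward_add_fee_frontier ρ P d]
    simp
    ring

theorem tendsto_gain_frontier (hρ : 0 ≤ ρ) (P : Player) :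
    Tendsto (gain α R ρ (regFrontierOCF n) (legFrontier n) P) atTop
      (𝓝 (share α R P * (1 + resource α R * ρ))) := by
  obtain ⟨hw0, hw1⟩ := share_mem_Icc (α := α) (R := R) P
  -- The only error is the expected claim on the last pending fee, which is between 0 and `ρ`.
  have hbound : ∀ d : ℕ, 0 < d →
      |gain α R ρ (regFrontierOCF n) (legFrontier n) P d
        - share α R P * (1 + resource α R * ρ)| ≤ ρ / d := by
    intro d hd
    have hd' : (0 : ℝ) < d := Nat.cast_pos.2 hd
    set F := ∫ ω, share α R P *
      feeOnTop ρ (chainAt R (regFrontierOCF n) (legFrontier n) ω d) ∂(notarizerLaw α) with hF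
    have hfee : Integrable (fun ω => share α R P *
        feeOnTop ρ (chainAt R (regFrontierOCF n) (legFrontier n) ω d)) (notarizerLaw α) :=
      integrable_comp_chainAt _ _ (fun c => share α R P * feeOnTop ρ c) d
    have hsum := integral_reward_add_fee_frontier (α := α) (R := R) ρ P d
    rw [integral_add (integrable_comp_chainAt _ _ _ d) hfee] at hsum
    have hF0 : 0 ≤ F := integral_nonneg fun ω => mul_nonneg hw0 (feeOnTop_nonneg hρ _)
    have hF1 : F ≤ ρ := by
      calc F ≤ ∫ _, ρ ∂(notarizerLaw α) := integral_mono hfee (integrable_const _) fun ω =>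
            (mul_le_mul hw1 (feeOnTop_le hρ _) (feeOnTop_nonneg hρ _) zero_le_one).trans
              (one_mul ρ).le
        _ = ρ := by simp
    have hgain : gain α R ρ (regFrontierOCF n) (legFrontier n) P d
        - share α R P * (1 + resource α R * ρ) = -(F / d) := by
      unfold gain
      simp only [epochReward_legFrontier]
      rw [eq_sub_of_add_eq hsum]
      field_simp
      ring
    rw [hgain, abs_neg, abs_of_nonneg (div_nonneg hF0 hd'.le)]
    gcongr
  rw [tendsto_iff_norm_sub_tendsto_zero]
  refine squeeze_zero' (Eventually.of_forall fun _ => norm_nonneg _) ?_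
    (tendsto_const_div_atTop_nhds_zero_nat ρ)
  filter_upwards [eventually_gt_atTop 0] with d hd
  exact hbound d hd

/-- The charge per epoch is the unregulated gain under frontier play, so the supermartingale bound
is met exactly in the limit. -/
theorem isNashEquilibrium_of_isSupersolution (hρ : 0 ≤ ρ) {V : State → ℝ} (hV : ∀ s, 0 ≤ V s)
    (hV0 : V State.initial = 0)
    (hsup : IsSupersolution (resource α R) ρ
      ((1 - resource α R) * (1 + resource α R * ρ)) V) :
    IsNashEquilibrium α R ρ (regFrontierOCF n) (legFrontier n) := by
  have h0 := resource_nonneg α R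
  have h1 : 0 ≤ 1 - resource α R := sub_nonneg.2 (resource_le_one α R)
  refine ⟨_, _, tendsto_gain_frontier hρ .regulated, tendsto_gain_frontier hρ .unregulated,
    fun τ ε hε => ?_, fun τ ε hε => Eventually.of_forall fun d => ?_⟩
  · filter_upwards [(tendsto_gain_frontier (α := α) (R := R) hρ .regulated).eventually_le_const
      (lt_add_of_pos_right _ hε)] with d hd
    exact (gain_regulated_le_regFrontierOCF hρ τ .regulated d).trans hd
  · exact (gain_unregulated_le hρ (by positivity) hV hV0 hsup τ d).trans
      (le_add_of_nonneg_right hε.le)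

end Frontier

end RegulatedChain

theorem theorem9 :
    ∃ ρ : ℝ → ℝ, (∀ x : ℝ, 1 / 2 < x → 0 < ρ x) ∧
      ∀ (n : ℕ) (α : PMF (Fin n)) (R : Finset (Fin n)),
        1 / 2 < RegulatedChain.resource α R →
          RegulatedChain.IsNashEquilibrium α R (ρ (RegulatedChain.resource α R))
            (RegulatedChain.regFrontierOCF n) (RegulatedChain.legFrontier n) := by
  classical
  -- At `x = 1` the formula `1 / (1 - x)` degenerates; the unregulated side then earns nothing, and
  -- the fee 1 serves.
  refine ⟨fun x => if x < 1 then 1 / (1 - x) else 1, fun x _ => ?_, fun n α R hR => ?_⟩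
  · dsimp only
    split_ifs with h
    · exact one_div_pos.2 (sub_pos.2 h)
    · exact one_pos
  · dsimp only
    split_ifs with h
    · have hq := sub_pos.2 h
      refine RegulatedChain.isNashEquilibrium_of_isSupersolution (one_div_pos.2 hq).le
        RegulatedChain.State.value_nonneg RegulatedChain.State.value_initial ?_
      have hlam : (1 - RegulatedChain.resource α R)
          * (1 + RegulatedChain.resource α R * (1 / (1 - RegulatedChain.resource α R))) = 1 := by
        field_simp
        ring
      rw [hlam]
      exact RegulatedChain.isSupersolution_value hR h
    · have h1 : RegulatedChain.resource α R = 1 :=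
        (RegulatedChain.resource_le_one α R).antisymm (not_lt.1 h)
      refine RegulatedChain.isNashEquilibrium_of_isSupersolution zero_le_one
        (V := fun _ => 0) (fun _ => le_rfl) rfl ?_
      rw [show (1 - RegulatedChain.resource α R) * (1 + RegulatedChain.resource α R * 1) = 0 by
        rw [h1]; ring]
      exact RegulatedChain.isSupersolution_zero h1
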